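/- Let $G=(V,E)$ be a finite, simple, connected graph. A spanning tree of $G$ is a maximal acyclic set $T\subseteq E$ of edges; let $\mathcal T(G)$ be the set of spanning trees and $e_T\in\mathbb R^E$ the indicator vector of $T$. The spanning tree polytope is $P(G)=\operatorname{conv}(e_T\mid T\in\mathcal T(G))\subset\mathbb R^E$, and the open spanning tree polytope $P(G)^\circ$ is its relative interior in its affine span. A distribution on $\mathcal T(G)$ is a function $\mu:\mathcal T(G)\to[0,\infty)$ with $\sum_T\mu(T)=1$, and its edge marginals are the vector $\big(\sum_{T\ni e}\mu(T)\big)_{e\in E}\in\mathbb R^E$. For positive edge weights $c\in\mathbb R_{>0}^E$ put $Z_G(c)=\sum_{T\in\mathcal T(G)}\prod_{t\in T}c_t$ and $$\mu_c(T)=\frac{\prod_{t\in T}c_t}{Z_G(c)}\quad(T\in\mathcal T(G)),\qquad r_e(c)=\frac{\sum_{T\ni e}\prod_{t\in T}c_t}{Z_G(c)}\quad(e\in E).$$ The numbers $r_e(c)$ are the relative resistances of the edges. A distribution $\mu$ is log-linear if $\mu=\mu_c$ for some $c\in\mathbb R_{>0}^E$; it is positive if $\mu(T)>0$ for every $T\in\mathcal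 T(G)$; it is non-separable if its support $\mathcal F=\{T\mid\mu(T)\neq 0\}$ is a non-separable set of spanning trees, which means that $\operatorname{conv}(e_T\mid T\in\mathcal F)$ intersects $P(G)^\circ$. A biconnected component of $G$ is a maximal induced subgraph that is connected and has no cut vertex (a single edge is allowed). Then the following subsets of $\mathbb R^E$ coincide: 1. the open spanning tree polytope $P(G)^\circ$; 2. the set of edge marginals of non-separable distributions on $\mathcal T(G)$; 3. the set of edge marginals of positive distributions on $\mathcal T(G)$; 4. the set of edge marginals of log-linear distributions on $\mathcal T(G)$; 5. the set of vectors of relative resistances $(r_e(c))_{e\in E}$, over all edge weights $c\in\mathbb R_{>0}^E$. Moreover, for every point $r$ of this set there are edge weights $c\in\mathbb R_{>0}^E$ with $r(c)=r$, and these are unique up to common rescaling in the biconnected components of $G$: edge weights $c'\in\mathbb R_{>0}^E$ satisfy $r(c')=r$ if and only if for every biconnected component $B$ of $G$ there is $a>0$ with $c'_e=a\,c_e$ for all edges $e$ of $B$. -/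

import Mathlib

namespace SimpleGraph

variable {V : Type*} (G : SimpleGraph V)

/-- A set of edges of `G` is a spanning tree if it is a maximal acyclic set of edges. -/
def IsSpanningTree (T : Finset G.edgeSet) : Prop :=
  Maximal (fun S : Finset G.edgeSet =>
    (fromEdgeSet (Subtype.val '' (S : Set G.edgeSet))).IsAcyclic) T

/-- The collection of all spanning trees of `G`. -/
abbrev SpanningTree : Type _ := {T : Finset G.edgeSet // G.IsSpanningTree T}

noncomputable instance instFintypeSpanningTree [Finite V] : Fintype G.SpanningTree :=
  Fintype.ofFinite _

variable {G} in
/-- The indicator vector `e_T` of a spanning tree. -/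
noncomputable def SpanningTree.vec (T : G.SpanningTree) : G.edgeSet → ℝ :=
  Set.indicator (T.1 : Set G.edgeSet) 1

/-- The spanning tree polytope. -/
def spanningTreePolytope : Set (G.edgeSet → ℝ) :=
  convexHull ℝ (Set.range fun T : G.SpanningTree => T.vec)

/-- The open spanning tree polytope: the relative interior of the spanning tree polytope in its
affine span. -/
def openSpanningTreePolytope : Set (G.edgeSet → ℝ) :=
  intrinsicInterior ℝ G.spanningTreePolytope

/-- A set of spanning trees is non-separable if the convex hull of its indicator vectors
meets the open spanning tree polytope. -/
def IsNonSeparableFamily (F : Set G.SpanningTree) : Prop :=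
  (convexHull ℝ (SpanningTree.vec '' F) ∩ G.openSpanningTreePolytope).Nonempty

section Finite

variable [Finite V]

/-- The Kirchhoff polynomial of `G`, evaluated at the edge weights `c`. -/
noncomputable def kirchhoff (c : G.edgeSet → ℝ) : ℝ :=
  ∑ T : G.SpanningTree, ∏ t ∈ T.1, c t

open Classical in
/-- The relative resistances of the edges of `G` with edge weights `c`. -/
noncomputable def relativeResistance (c : G.edgeSet → ℝ) : G.edgeSet → ℝ := fun e =>
  (∑ T : G.SpanningTree with e ∈ T.1, ∏ t ∈ T.1, c t) / G.kirchhoff c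

/-- The probability distributions on the set of spanning trees of `G`. -/
def treeDistributions : Set (G.SpanningTree → ℝ) :=
  {μ | (∀ T, 0 ≤ μ T) ∧ ∑ T, μ T = 1}

/-- A distribution is non-separable if its support is a non-separable set of spanning trees. -/
def nonSeparableDistributions : Set (G.SpanningTree → ℝ) :=
  {μ | μ ∈ G.treeDistributions ∧ G.IsNonSeparableFamily (Function.support μ)}

/-- A distribution is positive if every spanning tree has positive probability. -/
def positiveDistributions : Set (G.SpanningTree → ℝ) :=
  {μ | μ ∈ G.treeDistributions ∧ ∀ T, 0 < μ T}

/-- The distribution on spanning trees whose probabilities are proportional to the product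
of the weights of the edges of the tree. -/
noncomputable def weightedTreeDistribution (c : G.edgeSet → ℝ) : G.SpanningTree → ℝ := fun T =>
  (∏ t ∈ T.1, c t) / G.kirchhoff c

/-- The log-linear distributions are the ones that come from positive edge weights. -/
def logLinearDistributions : Set (G.SpanningTree → ℝ) :=
  {μ | ∃ c : G.edgeSet → ℝ, (∀ e, 0 < c e) ∧ μ = G.weightedTreeDistribution c}

open Classical in
/-- The edge marginals of a distribution on spanning trees. -/
noncomputable def edgeMarginals (μ : G.SpanningTree → ℝ) : G.edgeSet → ℝ := fun e =>
  ∑ T : G.SpanningTree with e ∈ T.1, μ T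

end Finite

/-- A graph is biconnected if it is connected and removing any vertex leaves no two remaining
vertices disconnected. The one-vertex graph and the one-edge graph are biconnected. -/
def IsBiconnected {W : Type*} (H : SimpleGraph W) : Prop :=
  H.Connected ∧ ∀ v : W, (H.induce {v}ᶜ).Preconnected

/-- `U` is the vertex set of a biconnected component (block) of `G`: a maximal set of vertices
that induces a biconnected subgraph. -/
def IsBiconnectedComponent (U : Set V) : Prop :=
  Maximal (fun W : Set V => (G.induce W).IsBiconnected) U

/-- Two choices of edge weights agree up to common rescaling in each of the biconnected
components of `G`. -/
def EqUpToRescaling (c c' : G.edgeSet → ℝ) : Prop :=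
  ∀ U : Set V, G.IsBiconnectedComponent U →
    ∃ a : ℝ, 0 < a ∧ ∀ e : G.edgeSet, (∀ v ∈ (e : Sym2 V), v ∈ U) → c' e = a * c e

end SimpleGraph

/-!
Taking marginals is the linear map `μ ↦ ∑ T, μ T • e_T`, so the open spanning tree polytope is the
set of marginals of positive distributions because the relative interior of a polytope consists
of the convex combinations of all its generators with positive coefficients
(`mem_intrinsicInterior_convexHull_range`). A non-separable distribution can be made positive
without changing its marginals.

Given a positive distribution `ρ` with marginals `m`, weights with these marginals come from convex
duality: a critical point `l` of `l ↦ ∑ T, exp (⟨l, e_T⟩ - ⟨l, m⟩)` yields the weights `exp l`. The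
vectors `(⟨l, e_T⟩ - ⟨l, m⟩)_T` form a subspace orthogonal to `ρ`, and on such a subspace the sum of
exponentials is coercive (`Submodule.exists_sum_mul_exp_eq_zero`).

For uniqueness, the symmetrized relative entropy of two log-linear distributions depends only on
their marginals, so weights `c` and `c'` have the same relative resistances if and only if
`∏ t ∈ T, c' t / c t` is the same for all spanning trees `T`. This means that `c' / c` is constant
on every block. In one direction, spanning trees are linked by exchanges of two edges on a common
cycle, and a cycle lies in a block (`SimpleGraph.Connected.prod_spanningTree_eq`). In the other
direction, two adjacent edges of a block lie on a common cycle, since their common vertex is not a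
cut vertex, and some pair of spanning trees differs by exactly the exchange of these two edges
(`SimpleGraph.Connected.eq_of_isBiconnectedComponent`).
-/

/-! ### The relative interior of a polytope -/

section RelativeInterior

variable {W : Type*} [NormedAddCommGroup W] [NormedSpace ℝ W]

theorem mem_intrinsicInterior_iff_exists_dist_lt {s : Set W} {x : W} :
    x ∈ intrinsicInterior ℝ s ↔
      x ∈ affineSpan ℝ s ∧ ∃ δ > 0, ∀ y ∈ affineSpan ℝ s, dist y x < δ → y ∈ s := by
  rw [mem_intrinsicInterior]
  constructor
  · rintro ⟨y, hy, rfl⟩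
    rw [mem_interior_iff_mem_nhds, Metric.mem_nhds_iff] at hy
    obtain ⟨δ, hδ, h⟩ := hy
    exact ⟨y.2, δ, hδ, fun z hz hzy => @h ⟨z, hz⟩ hzy⟩
  · rintro ⟨hx, δ, hδ, h⟩
    refine ⟨⟨x, hx⟩, ?_, rfl⟩
    rw [mem_interior_iff_mem_nhds, Metric.mem_nhds_iff]
    exact ⟨δ, hδ, fun z hz => h z z.2 hz⟩

/-- Shrinking a convex set towards one of its points `y` maps a neighbourhood of `x` in the
affine span onto a neighbourhood of the image of `x`. -/
theorem Convex.combo_mem_intrinsicInterior {s : Set W} (hs : Convex ℝ s) {x y : W}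
    (hx : x ∈ intrinsicInterior ℝ s) (hy : y ∈ s) {ε : ℝ} (hε : 0 < ε) (hε1 : ε ≤ 1) :
    ε • x + (1 - ε) • y ∈ intrinsicInterior ℝ s := by
  rw [mem_intrinsicInterior_iff_exists_dist_lt] at hx ⊢
  obtain ⟨hxs, δ, hδ, h⟩ := hx
  have hys := subset_affineSpan ℝ s hy
  refine ⟨?_, ε * δ, by positivity, fun z hz hzd => ?_⟩
  · have := AffineMap.lineMap_mem ε hys hxs
    rwa [AffineMap.lineMap_apply_module, add_comm] at this
  · have hz' := h (AffineMap.lineMap y z ε⁻¹) (AffineMap.lineMap_mem _ hys hz) ?_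
    · convert hs hz' hy hε.le (sub_nonneg.2 hε1) (by ring) using 1
      rw [AffineMap.lineMap_apply_module]
      match_scalars
      · field_simp
      · field_simp
        ring
    · have : AffineMap.lineMap y z ε⁻¹ - x = ε⁻¹ • (z - (ε • x + (1 - ε) • y)) := by
        rw [AffineMap.lineMap_apply_module]
        match_scalars <;> (field_simp; try ring)
      rw [dist_eq_norm] at hzd ⊢
      rw [this, norm_smul, norm_inv, Real.norm_of_nonneg hε.le, inv_mul_lt_iff₀ hε]
      exact hzd

/-- Convex combinations of the points `v i` with `i ∈ F`, with weights indexed by all of `ι`. -/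
theorem mem_convexHull_image_iff {W ι : Type*} [AddCommGroup W] [Module ℝ W] [Fintype ι]
    (v : ι → W) (F : Set ι) {y : W} :
    y ∈ convexHull ℝ (v '' F) ↔ ∃ w : ι → ℝ,
      (∀ i, 0 ≤ w i) ∧ (∀ i ∉ F, w i = 0) ∧ ∑ i, w i = 1 ∧ ∑ i, w i • v i = y := by
  classical
  constructor
  · intro hy
    refine convexHull_min (t := {y | ∃ w : ι → ℝ, (∀ i, 0 ≤ w i) ∧ (∀ i ∉ F, w i = 0) ∧
      ∑ i, w i = 1 ∧ ∑ i, w i • v i = y}) ?_ ?_ hy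
    · rintro _ ⟨i, hi, rfl⟩
      refine ⟨Pi.single i 1, fun j => ?_, fun j hj => ?_, by simp, by simp [Pi.single_apply]⟩
      · by_cases h : j = i
        · subst h; simp
        · simp [h]
      · exact Pi.single_eq_of_ne (fun h : j = i => hj (h.symm ▸ hi)) _
    · rintro _ ⟨w, hw, hwF, hw1, rfl⟩ _ ⟨u, hu, huF, hu1, rfl⟩ a b ha hb hab
      refine ⟨fun i => a * w i + b * u i, fun i => ?_, fun i hi => ?_, ?_, ?_⟩
      · exact add_nonneg (mul_nonneg ha (hw i)) (mul_nonneg hb (hu i))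
      · simp [hwF i hi, huF i hi]
      · rw [Finset.sum_add_distrib, ← Finset.mul_sum, ← Finset.mul_sum, hw1, hu1]
        linarith
      · simp_rw [add_smul, mul_smul]
        rw [Finset.sum_add_distrib, Finset.smul_sum, Finset.smul_sum]
  · rintro ⟨w, hw, hwF, hw1, rfl⟩
    have h1 : ∑ i with i ∈ F, w i = ∑ i, w i := by
      refine Finset.sum_filter_of_ne fun i _ hi => ?_
      exact not_not.1 fun h => hi (hwF i h)
    have h2 : ∑ i with i ∈ F, w i • v i = ∑ i, w i • v i := by
      refine Finset.sum_filter_of_ne fun i _ hi => ?_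
      exact not_not.1 fun h => hi (by rw [hwF i h, zero_smul])
    rw [← h2]
    refine (convex_convexHull ℝ _).sum_mem (fun i _ => hw i) (h1.trans hw1) fun i hi => ?_
    exact subset_convexHull ℝ _ ⟨i, (Finset.mem_filter.1 hi).2, rfl⟩

/-- The relative interior of a polytope consists of the convex combinations of its generators in
which every generator has a positive coefficient. -/
theorem mem_intrinsicInterior_convexHull_range [FiniteDimensional ℝ W] {ι : Type*} [Fintype ι]
    [Nonempty ι] (v : ι → W) {x : W} :
    x ∈ intrinsicInterior ℝ (convexHull ℝ (Set.range v)) ↔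
      ∃ w : ι → ℝ, (∀ i, 0 < w i) ∧ ∑ i, w i = 1 ∧ ∑ i, w i • v i = x := by
  have hull : ∀ {y : W}, y ∈ convexHull ℝ (Set.range v) ↔
      ∃ w : ι → ℝ, (∀ i, 0 ≤ w i) ∧ ∑ i, w i = 1 ∧ ∑ i, w i • v i = y := by
    intro y
    rw [← Set.image_univ, mem_convexHull_image_iff]
    simp
  have hconv : Convex ℝ (convexHull ℝ (Set.range v)) := convex_convexHull ℝ _
  constructor
  · intro hx
    have hxs := intrinsicInterior_subset hx
    obtain ⟨-, δ, hδ, h⟩ := mem_intrinsicInterior_iff_exists_dist_lt.1 hx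
    have hn : (0 : ℝ) < Fintype.card ι := by exact_mod_cast Fintype.card_pos
    set b : W := ∑ i, (Fintype.card ι : ℝ)⁻¹ • v i with hb
    have hbs : b ∈ convexHull ℝ (Set.range v) :=
      hull.2 ⟨_, fun _ => by positivity, by simp, rfl⟩
    -- Moving away from the barycentre `b` by a small amount stays inside the polytope.
    set t : ℝ := δ / (2 * (‖x - b‖ + 1)) with ht
    have htpos : 0 < t := by positivity
    have hy : x + t • (x - b) ∈ convexHull ℝ (Set.range v) := by
      refine h _ ?_ ?_
      · have := AffineMap.lineMap_mem (1 + t) (subset_affineSpan ℝ _ hbs)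
          (subset_affineSpan ℝ _ hxs)
        convert this using 1
        rw [AffineMap.lineMap_apply_module]
        module
      · rw [dist_eq_norm, add_sub_cancel_left, norm_smul, Real.norm_of_nonneg htpos.le, ht,
          div_mul_eq_mul_div, div_lt_iff₀ (by positivity)]
        nlinarith [norm_nonneg (x - b)]
    obtain ⟨u, hu0, hu1, hu⟩ := hull.1 hy
    refine ⟨fun i => (u i + t * (Fintype.card ι : ℝ)⁻¹) / (1 + t), fun i => ?_, ?_, ?_⟩
    · have := hu0 i
      positivity
    · rw [← Finset.sum_div, Finset.sum_add_distrib, hu1]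
      simp
      field_simp
    · have h1 : (1 + t) ≠ 0 := by positivity
      have : ∀ i, ((u i + t * (Fintype.card ι : ℝ)⁻¹) / (1 + t)) • v i =
          (1 + t)⁻¹ • (u i • v i + t • (Fintype.card ι : ℝ)⁻¹ • v i) := by
        intro i; module
      simp_rw [this]
      rw [← Finset.smul_sum, Finset.sum_add_distrib, hu, ← Finset.smul_sum, ← hb]
      rw [inv_smul_eq_iff₀ h1]
      module
  · rintro ⟨w, hw0, hw1, rfl⟩
    obtain ⟨z, hz⟩ := ((convexHull_nonempty_iff (𝕜 := ℝ)).2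
      (Set.range_nonempty v)).intrinsicInterior hconv
    obtain ⟨u, hu0, hu1, rfl⟩ := hull.1 (intrinsicInterior_subset hz)
    obtain ⟨j, hj⟩ := Finite.exists_min w
    have hwj : w j ≤ 1 := hw1 ▸ Finset.single_le_sum (fun i _ => (hw0 i).le) (Finset.mem_univ j)
    have hu_le : ∀ i, u i ≤ 1 := fun i =>
      hu1 ▸ Finset.single_le_sum (fun i _ => hu0 i) (Finset.mem_univ i)
    -- The factor `1 / 2` keeps the remaining weight `1 - ε` nonzero.
    set ε : ℝ := w j / 2 with hε
    have hwjpos := hw0 j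
    have hε0 : 0 < ε := by positivity
    have hε1 : 0 < 1 - ε := by rw [hε]; linarith
    have hy : ∑ i, ((w i - ε * u i) / (1 - ε)) • v i ∈ convexHull ℝ (Set.range v) := by
      refine hull.2 ⟨_, fun i => div_nonneg ?_ hε1.le, ?_, rfl⟩
      · have := hj i
        have := hu_le i
        nlinarith
      · rw [← Finset.sum_div, Finset.sum_sub_distrib, ← Finset.mul_sum, hw1, hu1, mul_one,
          div_self hε1.ne']
    convert hconv.combo_mem_intrinsicInterior hz hy hε0 (by linarith) using 1
    rw [Finset.smul_sum, Finset.smul_sum, ← Finset.sum_add_distrib]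
    refine Finset.sum_congr rfl fun i _ => ?_
    rw [smul_smul, smul_smul, ← add_smul]
    congr 1
    field_simp
    ring

end RelativeInterior

/-! ### Minimizing sums of exponentials -/

/-- If the subspace `U` is orthogonal to a positive vector `ρ`, then the function
`u ↦ ∑ i, exp (u i)` has a critical point on `U`. On `U` the negative parts of a vector are
controlled by its positive parts, so that the function is coercive and attains its minimum. -/
theorem Submodule.exists_sum_mul_exp_eq_zero {ι : Type*} [Fintype ι] (U : Submodule ℝ (ι → ℝ))
    (ρ : ι → ℝ) (hρ : ∀ i, 0 < ρ i) (hU : ∀ u ∈ U, ∑ i, ρ i * u i = 0) :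
    ∃ u ∈ U, ∀ d ∈ U, ∑ i, d i * Real.exp (u i) = 0 := by
  classical
  set F : (ι → ℝ) → ℝ := fun u => ∑ i, Real.exp (u i)
  have hFc : Continuous F := by fun_prop
  obtain ⟨n, hn⟩ : ∃ n : ℝ, n = Fintype.card ι := ⟨_, rfl⟩
  have hn0 : 0 ≤ n := hn ▸ Nat.cast_nonneg _
  set M : ℝ := ∑ i, ρ i
  have hM0 : 0 ≤ M := Finset.sum_nonneg fun i _ => (hρ i).le
  -- Sublevel sets of `F` on `U` lie in a box.
  have hbox : ∀ u ∈ U, F u ≤ n → ∀ i, u i ∈ Set.Icc (-(M * n / ρ i)) n := by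
    intro u hu hFu
    have hle : ∀ i, u i ≤ n := fun i =>
      calc u i ≤ Real.exp (u i) := by linarith [Real.add_one_le_exp (u i)]
        _ ≤ F u := Finset.single_le_sum (f := fun i => Real.exp (u i))
            (fun i _ => (Real.exp_pos _).le) (Finset.mem_univ i)
        _ ≤ n := hFu
    refine fun i => ⟨?_, hle i⟩
    have h1 : -(ρ i * u i) = ∑ j ∈ Finset.univ.erase i, ρ j * u j := by
      have := hU u hu
      rw [← Finset.add_sum_erase _ _ (Finset.mem_univ i)] at this
      linarith
    have h2 : ∑ j ∈ Finset.univ.erase i, ρ j * u j ≤ M * n := by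
      calc _ ≤ ∑ j ∈ Finset.univ.erase i, ρ j * n :=
            Finset.sum_le_sum fun j _ => mul_le_mul_of_nonneg_left (hle j) (hρ j).le
        _ ≤ ∑ j, ρ j * n := Finset.sum_le_sum_of_subset_of_nonneg (Finset.erase_subset _ _)
            fun j _ _ => mul_nonneg (hρ j).le hn0
        _ = M * n := by rw [Finset.sum_mul]
    rw [← neg_div, div_le_iff₀ (hρ i)]
    linarith
  have hcomp : IsCompact ((U : Set (ι → ℝ)) ∩ {u | F u ≤ n}) := by
    refine IsCompact.of_isClosed_subset (isCompact_univ_pi fun i =>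
      isCompact_Icc (a := -(M * n / ρ i)) (b := n)) ?_ ?_
    · exact (Submodule.closed_of_finiteDimensional U).inter (isClosed_le hFc continuous_const)
    · exact fun u hu i _ => hbox u hu.1 hu.2 i
  obtain ⟨u, hu, hmin⟩ := hcomp.exists_isMinOn
    ⟨0, U.zero_mem, by simp [F, hn]⟩ hFc.continuousOn
  refine ⟨u, hu.1, fun d hd => ?_⟩
  have hder : HasDerivAt (fun t : ℝ => ∑ i, Real.exp (u i + t * d i))
      (∑ i, d i * Real.exp (u i)) 0 := by
    have : ∀ i ∈ Finset.univ, HasDerivAt (fun t : ℝ => Real.exp (u i + t * d i))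
        (d i * Real.exp (u i)) 0 := by
      intro i _
      have := (((hasDerivAt_id (0 : ℝ)).mul_const (d i)).const_add (u i)).exp
      simpa [mul_comm] using this
    exact HasDerivAt.fun_sum this
  refine IsLocalMin.hasDerivAt_eq_zero (Filter.Eventually.of_forall fun t => ?_) hder
  have hmem : u + t • d ∈ U := U.add_mem hu.1 (U.smul_mem _ hd)
  have key : F u ≤ F (u + t • d) := by
    by_cases h : F (u + t • d) ≤ n
    · exact hmin ⟨hmem, h⟩
    · exact hu.2.trans (not_le.1 h).le
  simpa [F] using key

/-- The symmetrized relative entropy of two positive functions vanishes only if they agree. -/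
theorem eq_of_sum_sub_mul_log_sub_eq_zero {ι : Type*} [Fintype ι] {p q : ι → ℝ}
    (hp : ∀ i, 0 < p i) (hq : ∀ i, 0 < q i)
    (h : ∑ i, (p i - q i) * (Real.log (p i) - Real.log (q i)) = 0) : p = q := by
  have hnn : ∀ i ∈ Finset.univ, 0 ≤ (p i - q i) * (Real.log (p i) - Real.log (q i)) := by
    intro i _
    rcases le_total (p i) (q i) with hle | hle
    · exact mul_nonneg_of_nonpos_of_nonpos (sub_nonpos.2 hle)
        (sub_nonpos.2 (Real.log_le_log (hp i) hle))
    · exact mul_nonneg (sub_nonneg.2 hle) (sub_nonneg.2 (Real.log_le_log (hq i) hle))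
  funext i
  rcases mul_eq_zero.1 ((Finset.sum_eq_zero_iff_of_nonneg hnn).1 h i (Finset.mem_univ i)) with h | h
  · exact sub_eq_zero.1 h
  · exact Real.log_injOn_pos (hp i) (hq i) (sub_eq_zero.1 h)

namespace SimpleGraph

variable {V : Type*} {G : SimpleGraph V}

/-! ### Spanning trees and exchanges of edges -/

/-- The graph on the vertices of `G` whose edges are the members of `T`. -/
abbrev edgeGraph (T : Finset G.edgeSet) : SimpleGraph V :=
  fromEdgeSet (Subtype.val '' (T : Set G.edgeSet))

theorem edgeSet_edgeGraph (T : Finset G.edgeSet) :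
    (edgeGraph T).edgeSet = Subtype.val '' (T : Set G.edgeSet) := by
  rw [edgeSet_fromEdgeSet, sdiff_eq_left, Set.disjoint_left]
  rintro _ ⟨e, -, rfl⟩
  exact G.not_isDiag_of_mem_edgeSet e.2

theorem coe_mem_edgeSet_edgeGraph {T : Finset G.edgeSet} {e : G.edgeSet} :
    (e : Sym2 V) ∈ (edgeGraph T).edgeSet ↔ e ∈ T := by
  rw [edgeSet_edgeGraph, Subtype.val_injective.mem_set_image, Finset.mem_coe]

theorem edgeGraph_le (T : Finset G.edgeSet) : edgeGraph T ≤ G := by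
  rw [← edgeSet_subset_edgeSet, edgeSet_edgeGraph]
  rintro _ ⟨e, -, rfl⟩
  exact e.2

theorem exists_edgeGraph_eq [Finite V] {H : SimpleGraph V} (hH : H ≤ G) :
    ∃ T : Finset G.edgeSet, edgeGraph T = H := by
  refine ⟨(Set.toFinite {e : G.edgeSet | (e : Sym2 V) ∈ H.edgeSet}).toFinset, ?_⟩
  rw [← edgeSet_inj, edgeSet_edgeGraph]
  ext e
  simp only [Set.Finite.coe_toFinset, Set.mem_image, Set.mem_ofPred_eq]
  exact ⟨by rintro ⟨e, he, rfl⟩; exact he, fun he => ⟨⟨e, edgeSet_mono hH he⟩, he, rfl⟩⟩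

theorem edgeGraph_le_edgeGraph {S T : Finset G.edgeSet} : edgeGraph S ≤ edgeGraph T ↔ S ≤ T := by
  rw [← edgeSet_subset_edgeSet, edgeSet_edgeGraph, edgeSet_edgeGraph,
    Set.image_subset_image_iff Subtype.val_injective, Finset.coe_subset]

theorem isSpanningTree_iff_isTree [Finite V] (hG : G.Connected) {T : Finset G.edgeSet} :
    G.IsSpanningTree T ↔ (edgeGraph T).IsTree := by
  rw [← hG.maximal_le_isAcyclic_iff_isTree (edgeGraph_le T)]
  constructor
  · refine fun h => ⟨⟨edgeGraph_le T, h.1⟩, fun H hH hle => ?_⟩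
    obtain ⟨S, rfl⟩ := exists_edgeGraph_eq hH.1
    exact edgeGraph_le_edgeGraph.2 (h.2 hH.2 (edgeGraph_le_edgeGraph.1 hle))
  · exact fun h => ⟨h.1.2, fun S hS hle => edgeGraph_le_edgeGraph.1
      (h.2 ⟨edgeGraph_le S, hS⟩ (edgeGraph_le_edgeGraph.2 hle))⟩

theorem Connected.nonempty_spanningTree [Finite V] (hG : G.Connected) :
    Nonempty G.SpanningTree := by
  obtain ⟨H, hH, hT⟩ := hG.exists_isTree_le
  obtain ⟨T, rfl⟩ := exists_edgeGraph_eq hH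
  exact ⟨⟨T, (isSpanningTree_iff_isTree hG).2 hT⟩⟩

open Classical in
/-- Adding an edge `s(x, y)` to a spanning tree creates a cycle, and deleting any other edge of
that cycle leaves a connected graph with the right number of edges. -/
theorem IsTree.edgeGraph_insert_erase [Finite V] {T : Finset G.edgeSet}
    (hT : (edgeGraph T).IsTree) {x y : V} (hxy : G.Adj x y)
    (hf : (⟨s(x, y), hxy⟩ : G.edgeSet) ∉ T) {p : (edgeGraph T).Walk x y} (hp : p.IsPath)
    {e : G.edgeSet} (heT : e ∈ T) (he : (e : Sym2 V) ∈ p.edges) :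
    (edgeGraph (insert ⟨s(x, y), hxy⟩ (T.erase e))).IsTree := by
  set f : G.edgeSet := ⟨s(x, y), hxy⟩
  have hef : e ≠ f := fun h => hf (h ▸ heT)
  have hle : edgeGraph T ≤ edgeGraph (insert f T) :=
    edgeGraph_le_edgeGraph.2 (Finset.subset_insert _ _)
  have hadj : (edgeGraph (insert f T)).Adj y x := by
    rw [adj_comm, ← mem_edgeSet]
    exact (coe_mem_edgeSet_edgeGraph (e := f)).2 (Finset.mem_insert_self _ _)
  have hcyc : (Walk.cons hadj (p.mapLe hle)).IsCycle := by
    refine Path.cons_isCycle ⟨p.mapLe hle, (Walk.isPath_mapLe hle).2 hp⟩ hadj ?_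
    intro h
    rw [Sym2.eq_swap] at h
    simp only [Walk.edges_mapLe_eq_edges] at h
    exact hf ((coe_mem_edgeSet_edgeGraph (e := f)).1 (p.edges_subset_edgeSet h))
  have hbr : ¬ (edgeGraph (insert f T)).IsBridge e := by
    intro h
    refine h.notMem_edges_of_isCycle hcyc ?_
    simp [he]
  have hdel : edgeGraph (insert f (T.erase e)) = (edgeGraph (insert f T)).deleteEdges {↑e} := by
    rw [← edgeSet_inj, edgeSet_deleteEdges, edgeSet_edgeGraph, edgeSet_edgeGraph,
      ← Finset.erase_insert_of_ne hef.symm, Finset.coe_erase, Set.image_sdiff Subtype.val_injective,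
      Set.image_singleton]
  have hcard : ∀ S : Finset G.edgeSet, Nat.card (edgeGraph S).edgeSet = S.card := by
    intro S
    rw [edgeSet_edgeGraph, Nat.card_image_of_injective Subtype.val_injective]
    simp
  rw [isTree_iff_connected_and_card] at hT ⊢
  constructor
  · rw [hdel]
    have hconn := hT.1.mono hle
    revert hbr
    induction (e : Sym2 V) with
    | h a b => exact fun hbr => hconn.connected_delete_edge_of_not_isBridge hbr
  · rw [hcard] at hT ⊢
    rw [Finset.card_insert_of_notMem (fun h => hf (Finset.mem_of_mem_erase h)),
      Finset.card_erase_of_mem heT, Nat.sub_add_cancel (Finset.card_pos.2 ⟨e, heT⟩), hT.2]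

theorem Walk.IsPath.isAcyclic_fromEdgeSet {a b : V} {p : G.Walk a b} (hp : p.IsPath) :
    (fromEdgeSet {e | e ∈ p.edges}).IsAcyclic := by
  induction p with
  | nil => simp
  | @cons a b c h p ih =>
    rw [Walk.cons_isPath_iff] at hp
    have : fromEdgeSet {e | e ∈ (Walk.cons h p).edges} =
        fromEdgeSet {e | e ∈ p.edges} ⊔ edge a b := by
      rw [edge, ← fromEdgeSet_union]
      congr 1
      ext e
      simp
    rw [this]
    refine (ih hp.1).sup_edge_of_not_reachable ?_
    -- The first vertex of the path is isolated in the graph of the remaining edges.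
    rintro ⟨q⟩
    cases q with
    | nil => exact h.ne rfl
    | cons h' _ =>
      rw [fromEdgeSet_adj] at h'
      exact hp.2 (p.fst_mem_support_of_mem_edges h'.1)

/-! ### Blocks -/

/-- A cycle has no cut vertex: after deleting `v`, every vertex of the path still reaches one of the
ends `x` and `y` along the path, and `x` and `y` are adjacent unless one of them is `v`. -/
theorem Walk.IsPath.isBiconnected_induce_support {x y : V} {p : G.Walk x y} (hp : p.IsPath)
    (hyx : G.Adj x y) : (G.induce {v | v ∈ p.support}).IsBiconnected := by
  classical
  refine ⟨p.connected_induce_support, fun v => ?_⟩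
  obtain ⟨v, hv⟩ := v
  set W : Set V := {v | v ∈ p.support}
  -- Walks along `p` that avoid `v` survive the deletion of `v`.
  have lift : ∀ {a b : V} (q : G.Walk a b) (_ : q.support ⊆ p.support) (_ : v ∉ q.support)
      (ha : (⟨a, ‹q.support ⊆ p.support› q.start_mem_support⟩ : W) ∈ ({⟨v, hv⟩}ᶜ : Set W))
      (hb : (⟨b, ‹q.support ⊆ p.support› q.end_mem_support⟩ : W) ∈ ({⟨v, hv⟩}ᶜ : Set W)),
      ((G.induce W).induce {⟨v, hv⟩}ᶜ).Reachable ⟨_, ha⟩ ⟨_, hb⟩ := by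
    intro a b q hq hvq ha hb
    refine ⟨(q.induce W fun z hz => hq hz).induce _ ?_⟩
    rintro ⟨z, hz⟩ hzq
    rw [Walk.support_induce] at hzq
    simp only [List.mem_attachWith] at hzq
    intro h
    have : z = v := congrArg Subtype.val h
    exact hvq (this ▸ hzq)
  have hxW : x ∈ W := p.start_mem_support
  have hyW : y ∈ W := p.end_mem_support
  have mem : ∀ {z : V} (hz : z ∈ W), z ≠ v → (⟨z, hz⟩ : W) ∈ ({⟨v, hv⟩}ᶜ : Set W) :=
    fun hz h h' => h (congrArg Subtype.val h')
  have key : ∀ z (hz : z ∈ W) (hzv : z ≠ v),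
      (∃ hxv : x ≠ v, ((G.induce W).induce {⟨v, hv⟩}ᶜ).Reachable
        ⟨⟨z, hz⟩, mem hz hzv⟩ ⟨⟨x, hxW⟩, mem hxW hxv⟩) ∨
      (∃ hyv : y ≠ v, ((G.induce W).induce {⟨v, hv⟩}ᶜ).Reachable
        ⟨⟨z, hz⟩, mem hz hzv⟩ ⟨⟨y, hyW⟩, mem hyW hyv⟩) := by
    intro z hz hzv
    by_cases h : v ∈ (p.takeUntil z hz).support
    · have h' : v ∉ (p.dropUntil z hz).support := by
        intro h'
        have hnd := hp.support_nodup
        rw [← p.take_spec hz, Walk.support_append] at hnd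
        refine List.disjoint_of_nodup_append hnd h ?_
        rw [Walk.mem_support_iff] at h'
        exact h'.resolve_left (Ne.symm hzv)
      have hyv : y ≠ v := fun hy => h' (hy ▸ Walk.end_mem_support _)
      exact Or.inr ⟨hyv, lift _ (p.support_dropUntil_subset_support hz) h' _ _⟩
    · have hxv : x ≠ v := fun hx => h (hx ▸ Walk.start_mem_support _)
      exact Or.inl ⟨hxv, (lift _ (p.support_takeUntil_subset_support hz) h (mem hxW hxv)
        (mem hz hzv)).symm⟩
  have hadj : ∀ (hxv : x ≠ v) (hyv : y ≠ v), ((G.induce W).induce {⟨v, hv⟩}ᶜ).Reachable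
      ⟨⟨x, hxW⟩, mem hxW hxv⟩ ⟨⟨y, hyW⟩, mem hyW hyv⟩ := fun hxv hyv => Adj.reachable hyx
  rintro ⟨⟨z, hz⟩, hzv⟩ ⟨⟨w, hw⟩, hwv⟩
  have hzv' : z ≠ v := fun h => hzv (Subtype.ext h)
  have hwv' : w ≠ v := fun h => hwv (Subtype.ext h)
  rcases key z hz hzv' with ⟨h1, r1⟩ | ⟨h1, r1⟩ <;> rcases key w hw hwv' with ⟨h2, r2⟩ | ⟨h2, r2⟩
  · exact r1.trans r2.symm
  · exact r1.trans ((hadj h1 h2).trans r2.symm)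
  · exact r1.trans ((hadj h2 h1).symm.trans r2.symm)
  · exact r1.trans r2.symm

theorem Walk.IsPath.exists_isBiconnectedComponent [Finite V] {x y : V} {p : G.Walk x y}
    (hp : p.IsPath) (hxy : G.Adj x y) :
    ∃ U, G.IsBiconnectedComponent U ∧ ∀ v ∈ p.support, v ∈ U := by
  obtain ⟨U, hU, hmax⟩ := Finite.exists_le_maximal
    (p := fun W : Set V => (G.induce W).IsBiconnected) (hp.isBiconnected_induce_support hxy)
  exact ⟨U, hmax, hU⟩

open Classical in
/-- Two spanning trees are joined by a sequence of exchanges in which an edge is replaced by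
another edge of the same block, since both lie on a common cycle. -/
theorem Connected.prod_spanningTree_eq [Finite V] (hG : G.Connected) {d : G.edgeSet → ℝ}
    (hd : ∀ U, G.IsBiconnectedComponent U → ∀ e f : G.edgeSet, (∀ v ∈ (e : Sym2 V), v ∈ U) →
      (∀ v ∈ (f : Sym2 V), v ∈ U) → d e = d f) {T T' : Finset G.edgeSet}
    (hT : G.IsSpanningTree T) (hT' : G.IsSpanningTree T') :
    ∏ t ∈ T, d t = ∏ t ∈ T', d t := by
  induction hn : (T \ T').card using Nat.strong_induction_on generalizing T with
  | _ n ih =>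
  subst hn
  by_cases hsub : T' ⊆ T
  · rw [hsub.antisymm (hT'.2 hT.1 hsub)]
  obtain ⟨⟨f, hfG⟩, hfT', hfT⟩ := Finset.not_subset.1 hsub
  induction f with
  | h x y =>
  have hfG' : G.Adj x y := hfG
  have tree := (isSpanningTree_iff_isTree hG).1 hT
  obtain ⟨p, hp⟩ := tree.connected.exists_isPath x y
  -- The path in `T` leaves `T'`: otherwise `f` would close a cycle in `T'`.
  obtain ⟨e, hep, heT'⟩ : ∃ e : G.edgeSet, (e : Sym2 V) ∈ p.edges ∧ e ∉ T' := by
    by_contra! hcon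
    have hbr := isAcyclic_iff_forall_isBridge.1 hT'.1 (coe_mem_edgeSet_edgeGraph.2 hfT')
    have hp' : ∀ e ∈ p.edges, e ∈ (edgeGraph T').edgeSet := fun e he =>
      (coe_mem_edgeSet_edgeGraph (e := ⟨e, edgeSet_mono (edgeGraph_le T)
        (p.edges_subset_edgeSet he)⟩)).2 (hcon _ he)
    have := isBridge_iff_forall_walk_mem_edges.1 hbr (p.transfer _ hp')
    rw [Walk.edges_transfer] at this
    exact hfT (coe_mem_edgeSet_edgeGraph.1 (p.edges_subset_edgeSet this))
  have heT : e ∈ T := coe_mem_edgeSet_edgeGraph.1 (p.edges_subset_edgeSet hep)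
  have hnew := (isSpanningTree_iff_isTree hG).2
    (tree.edgeGraph_insert_erase hfG' hfT hp heT hep)
  rw [← ih _ ?_ hnew rfl]
  · rw [Finset.prod_insert (fun h => hfT (Finset.mem_of_mem_erase h)),
      ← Finset.mul_prod_erase T d heT]
    congr 1
    obtain ⟨U, hU, hpU⟩ := Walk.IsPath.exists_isBiconnectedComponent
      ((Walk.isPath_mapLe (edgeGraph_le T)).2 hp) hfG'
    rw [Walk.support_mapLe_eq_support] at hpU
    refine hd U hU _ _ (fun v hv => hpU v ?_) (fun v hv => ?_)
    · exact p.mem_support_of_mem_edges hep hv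
    · rcases Sym2.mem_iff.1 hv with rfl | rfl
      · exact hpU _ p.start_mem_support
      · exact hpU _ p.end_mem_support
  · refine Finset.card_lt_card ((Finset.ssubset_iff_of_subset fun g hg => ?_).2
      ⟨e, Finset.mem_sdiff.2 ⟨heT, heT'⟩, fun h => ?_⟩)
    · rw [Finset.mem_sdiff, Finset.mem_insert] at hg
      refine Finset.mem_sdiff.2 ⟨?_, hg.2⟩
      rcases hg.1 with rfl | h
      · exact absurd hfT' hg.2
      · exact Finset.mem_of_mem_erase h
    · rw [Finset.mem_sdiff, Finset.mem_insert] at h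
      rcases h.1 with rfl | h
      · exact hfT heT
      · exact Finset.notMem_erase _ _ h

/-- Two edges `vu` and `vw` lie on a common cycle if `u` and `w` are joined by a path that avoids
`v`, and then some spanning tree allows to exchange one for the other. -/
theorem Connected.eq_of_prod_spanningTree_eq [Finite V] (hG : G.Connected) {d : G.edgeSet → ℝ}
    (hd0 : ∀ e, d e ≠ 0) (hd : ∀ T T' : Finset G.edgeSet, G.IsSpanningTree T →
      G.IsSpanningTree T' → ∏ t ∈ T, d t = ∏ t ∈ T', d t)
    {u v w : V} (hvu : G.Adj v u) (hvw : G.Adj v w) (huw : u ≠ w) {q : G.Walk u w}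
    (hq : q.IsPath) (hvq : v ∉ q.support) : d ⟨s(v, u), hvu⟩ = d ⟨s(v, w), hvw⟩ := by
  classical
  set p : G.Walk v w := Walk.cons hvu q with hp
  have hpath : p.IsPath := hq.cons hvq
  have hle : fromEdgeSet {e | e ∈ p.edges} ≤ G := by
    rw [fromEdgeSet_le]
    exact fun e he => p.edges_subset_edgeSet he.1
  obtain ⟨H, hpH, hHG, hH⟩ := hG.exists_isTree_le_of_le_of_isAcyclic hle
    hpath.isAcyclic_fromEdgeSet
  obtain ⟨T, rfl⟩ := exists_edgeGraph_eq hHG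
  have hpT : ∀ e ∈ p.edges, e ∈ (edgeGraph T).edgeSet := fun e he => by
    refine edgeSet_mono hpH ?_
    rw [edgeSet_fromEdgeSet]
    exact ⟨he, G.not_isDiag_of_mem_edgeSet (p.edges_subset_edgeSet he)⟩
  have hfp : s(v, w) ∉ p.edges := by
    rw [hp, Walk.edges_cons, List.mem_cons, not_or]
    refine ⟨fun h => huw ?_, fun h => hvq (q.fst_mem_support_of_mem_edges h)⟩
    exact (Sym2.congr_right.1 h).symm
  -- The tree already contains the path `p` from `v` to `w`.
  have hfT : (⟨s(v, w), hvw⟩ : G.edgeSet) ∉ T := by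
    intro h
    have hbr := isAcyclic_iff_forall_isBridge.1 hH.isAcyclic (coe_mem_edgeSet_edgeGraph.2 h)
    have := isBridge_iff_forall_walk_mem_edges.1 hbr (p.transfer _ hpT)
    rw [Walk.edges_transfer] at this
    exact hfp this
  have hep : s(v, u) ∈ p.edges := by simp [hp]
  have heT : (⟨s(v, u), hvu⟩ : G.edgeSet) ∈ T := coe_mem_edgeSet_edgeGraph.1 (hpT _ hep)
  have hnew := hH.edgeGraph_insert_erase hvw hfT (hpath.transfer hpT) heT
    (by rw [Walk.edges_transfer]; exact hep)
  have := hd _ _ ((isSpanningTree_iff_isTree hG).2 hH) ((isSpanningTree_iff_isTree hG).2 hnew)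
  rw [Finset.prod_insert (fun h => hfT (Finset.mem_of_mem_erase h)),
    ← Finset.mul_prod_erase T d heT] at this
  exact mul_right_cancel₀ (Finset.prod_ne_zero_iff.2 fun e _ => hd0 e) this

/-- In a block, adjacent edges `vu` and `vw` lie on a common cycle since `v` is not a cut vertex,
and connectedness links any two edges by a chain of adjacent ones. -/
theorem Connected.eq_of_isBiconnectedComponent [Finite V] (hG : G.Connected) {d : G.edgeSet → ℝ}
    (hd0 : ∀ e, d e ≠ 0) (hd : ∀ T T' : Finset G.edgeSet, G.IsSpanningTree T →
      G.IsSpanningTree T' → ∏ t ∈ T, d t = ∏ t ∈ T', d t)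
    {U : Set V} (hU : G.IsBiconnectedComponent U) (e f : G.edgeSet)
    (he : ∀ v ∈ (e : Sym2 V), v ∈ U) (hf : ∀ v ∈ (f : Sym2 V), v ∈ U) : d e = d f := by
  classical
  have adjacent : ∀ (v u w : U) (hvu : G.Adj v u) (hvw : G.Adj v w),
      d ⟨s((v : V), (u : V)), hvu⟩ = d ⟨s((v : V), (w : V)), hvw⟩ := by
    intro v u w hvu hvw
    by_cases huw : u = w
    · subst huw; rfl
    have hu : u ∈ ({v}ᶜ : Set U) := fun h => hvu.ne (congrArg Subtype.val h).symm
    have hw : w ∈ ({v}ᶜ : Set U) := fun h => hvw.ne (congrArg Subtype.val h).symm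
    obtain ⟨q⟩ := hU.1.2 v ⟨u, hu⟩ ⟨w, hw⟩
    let i : (G.induce U).induce {v}ᶜ →g G :=
      (Embedding.induce U).toHom.comp (Embedding.induce {v}ᶜ).toHom
    let q' : G.Walk u w := q.map i
    refine hG.eq_of_prod_spanningTree_eq hd0 hd hvu hvw (fun h => huw (Subtype.ext h))
      q'.bypass_isPath fun h => ?_
    have h := q'.support_bypass_subset_support h
    rw [show q'.support = q.support.map i from Walk.support_map i q, List.mem_map] at h
    obtain ⟨z, -, hz⟩ := h
    exact z.2 (Subtype.ext hz)
  have chain : ∀ (a x : U) (_ : (G.induce U).Walk a x) (b y : U) (hab : G.Adj a b)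
      (hxy : G.Adj x y), d ⟨s((a : V), (b : V)), hab⟩ = d ⟨s((x : V), (y : V)), hxy⟩ := by
    intro a x p
    induction p with
    | nil => exact fun b y hab hxy => adjacent _ b y hab hxy
    | @cons a c x h p ih =>
      intro b y hab hxy
      have hac : G.Adj a c := h
      rw [adjacent a b c hab hac, ← ih a y hac.symm hxy]
      congr 2
      exact Sym2.eq_swap
  obtain ⟨e, heG⟩ := e
  obtain ⟨f, hfG⟩ := f
  induction e with
  | h a b =>
  induction f with
  | h x y =>
  obtain ⟨p⟩ := hU.1.1.preconnected ⟨a, he a (Sym2.mem_mk_left a b)⟩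
    ⟨x, hf x (Sym2.mem_mk_left x y)⟩
  exact chain _ _ p ⟨b, he b (Sym2.mem_mk_right a b)⟩ ⟨y, hf y (Sym2.mem_mk_right x y)⟩ heG hfG

end SimpleGraph

namespace SimpleGraph

variable {V : Type*} [Finite V] {G : SimpleGraph V}

/-! ### Edge marginals and relative resistances -/

theorem edgeMarginals_eq_sum_smul_vec (μ : G.SpanningTree → ℝ) :
    G.edgeMarginals μ = ∑ T, μ T • T.vec := by
  classical
  funext e
  simp [edgeMarginals, SpanningTree.vec, Finset.sum_apply, Finset.sum_filter, Set.indicator_apply]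

theorem relativeResistance_eq_edgeMarginals (c : G.edgeSet → ℝ) :
    G.relativeResistance c = G.edgeMarginals (G.weightedTreeDistribution c) := by
  funext e
  simp only [relativeResistance, edgeMarginals, weightedTreeDistribution, Finset.sum_div]

theorem Connected.kirchhoff_pos (hG : G.Connected) {c : G.edgeSet → ℝ} (hc : ∀ e, 0 < c e) :
    0 < G.kirchhoff c :=
  have := hG.nonempty_spanningTree
  Finset.sum_pos (fun _ _ => Finset.prod_pos fun e _ => hc e) Finset.univ_nonempty

theorem Connected.weightedTreeDistribution_pos (hG : G.Connected) {c : G.edgeSet → ℝ}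
    (hc : ∀ e, 0 < c e) (T : G.SpanningTree) : 0 < G.weightedTreeDistribution c T :=
  div_pos (Finset.prod_pos fun e _ => hc e) (hG.kirchhoff_pos hc)

theorem Connected.weightedTreeDistribution_mem_positiveDistributions (hG : G.Connected)
    {c : G.edgeSet → ℝ} (hc : ∀ e, 0 < c e) :
    G.weightedTreeDistribution c ∈ G.positiveDistributions := by
  refine ⟨⟨fun T => (hG.weightedTreeDistribution_pos hc T).le, ?_⟩,
    hG.weightedTreeDistribution_pos hc⟩
  simp only [weightedTreeDistribution]
  rw [← Finset.sum_div]
  exact div_self (hG.kirchhoff_pos hc).ne'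

theorem Connected.openSpanningTreePolytope_eq_image_positiveDistributions (hG : G.Connected) :
    G.openSpanningTreePolytope = G.edgeMarginals '' G.positiveDistributions := by
  have := hG.nonempty_spanningTree
  have := Fintype.ofFinite G.edgeSet
  ext x
  rw [openSpanningTreePolytope, spanningTreePolytope, mem_intrinsicInterior_convexHull_range]
  constructor
  · rintro ⟨w, hw, hw1, rfl⟩
    exact ⟨w, ⟨⟨fun T => (hw T).le, hw1⟩, hw⟩, edgeMarginals_eq_sum_smul_vec w⟩
  · rintro ⟨w, ⟨⟨-, hw1⟩, hw⟩, rfl⟩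
    exact ⟨w, hw, hw1, (edgeMarginals_eq_sum_smul_vec w).symm⟩

/-- A distribution whose support spans a polytope meeting the open spanning tree polytope can be
made positive without changing its marginals: a small multiple of a distribution on the same
support is traded for the same multiple of a positive distribution with equal marginals. -/
theorem Connected.openSpanningTreePolytope_eq_image_nonSeparableDistributions
    (hG : G.Connected) :
    G.openSpanningTreePolytope = G.edgeMarginals '' G.nonSeparableDistributions := by
  have := hG.nonempty_spanningTree
  rw [hG.openSpanningTreePolytope_eq_image_positiveDistributions]
  apply Set.Subset.antisymm
  · rintro _ ⟨μ, hμ, rfl⟩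
    refine ⟨μ, ⟨hμ.1, G.edgeMarginals μ, ?_, ?_⟩, rfl⟩
    · rw [mem_convexHull_image_iff]
      exact ⟨μ, hμ.1.1, fun T hT => Function.notMem_support.1 hT, hμ.1.2,
        (edgeMarginals_eq_sum_smul_vec μ).symm⟩
    · rw [hG.openSpanningTreePolytope_eq_image_positiveDistributions]
      exact ⟨μ, hμ, rfl⟩
  · rintro _ ⟨μ, ⟨⟨hμ0, hμ1⟩, x, hx, hxo⟩, rfl⟩
    rw [mem_convexHull_image_iff] at hx
    obtain ⟨ν, hν0, hνμ, hν1, rfl⟩ := hx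
    rw [hG.openSpanningTreePolytope_eq_image_positiveDistributions] at hxo
    obtain ⟨ρ, ⟨⟨-, hρ1⟩, hρ⟩, hρν⟩ := hxo
    rw [edgeMarginals_eq_sum_smul_vec] at hρν
    have hν_le : ∀ T, ν T ≤ 1 := fun T =>
      hν1 ▸ Finset.single_le_sum (fun T _ => hν0 T) (Finset.mem_univ T)
    -- The weight `ε` is at most every nonzero value of `μ`, so that `ε • ν ≤ μ`.
    obtain ⟨ε, hε, hεμ⟩ : ∃ ε > 0, ∀ T, μ T ≠ 0 → ε ≤ μ T := by
      obtain ⟨T₀, hT₀⟩ := Finite.exists_min fun T => if μ T = 0 then 1 else μ T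
      refine ⟨_, ?_, fun T hT => (hT₀ T).trans_eq (if_neg hT)⟩
      split_ifs with h
      · exact one_pos
      · exact (hμ0 T₀).lt_of_ne' h
    have hpos : ∀ T, 0 < μ T - ε * ν T + ε * ρ T := by
      intro T
      have h1 := mul_pos hε (hρ T)
      have h2 : ε * ν T ≤ μ T := by
        by_cases h : μ T = 0
        · rw [hνμ T (Function.notMem_support.2 h), h, mul_zero]
        · exact (mul_le_of_le_one_right hε.le (hν_le T)).trans (hεμ T h)
      linarith
    refine ⟨fun T => μ T - ε * ν T + ε * ρ T, ⟨⟨fun T => (hpos T).le, ?_⟩, hpos⟩, ?_⟩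
    · rw [Finset.sum_add_distrib, Finset.sum_sub_distrib, ← Finset.mul_sum, ← Finset.mul_sum,
        hν1, hρ1, hμ1]
      ring
    · rw [edgeMarginals_eq_sum_smul_vec, edgeMarginals_eq_sum_smul_vec]
      simp_rw [add_smul, sub_smul, mul_smul]
      rw [Finset.sum_add_distrib, Finset.sum_sub_distrib, ← Finset.smul_sum, ← Finset.smul_sum,
        hρν, sub_add_cancel]

/-! ### Existence of weights with given marginals -/

open Classical in
/-- The weights are `exp (l e)` for a critical point `l` of the function
`l ↦ ∑ T, exp (⟨l, e_T⟩ - ⟨l, m⟩)`, where `m` is the vector of marginals of `ρ`: the partial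
derivatives of this function compare the marginals of the weighted distribution to `m`. -/
theorem Connected.exists_relativeResistance_eq (hG : G.Connected) {ρ : G.SpanningTree → ℝ}
    (hρ : ρ ∈ G.positiveDistributions) :
    ∃ c : G.edgeSet → ℝ, (∀ e, 0 < c e) ∧ G.relativeResistance c = G.edgeMarginals ρ := by
  obtain ⟨⟨-, hρ1⟩, hρ0⟩ := hρ
  let m : (G.edgeSet → ℝ) → ℝ := fun l => ∑ S : G.SpanningTree, ρ S * ∑ t ∈ S.1, l t
  let A : (G.edgeSet → ℝ) →ₗ[ℝ] (G.SpanningTree → ℝ) :=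
    { toFun := fun l T => ∑ t ∈ T.1, l t - m l
      map_add' := fun l l' => by
        funext T
        simp only [m, Pi.add_apply, Finset.sum_add_distrib, mul_add]
        ring
      map_smul' := fun a l => by
        funext T
        simp only [m, Pi.smul_apply, smul_eq_mul, ← Finset.mul_sum, RingHom.id_apply, mul_sub,
          mul_left_comm _ a] }
  have hA : ∀ l T, A l T = ∑ t ∈ T.1, l t - m l := fun _ _ => rfl
  obtain ⟨_, ⟨l, rfl⟩, hl⟩ := (LinearMap.range A).exists_sum_mul_exp_eq_zero ρ hρ0 (by
    rintro _ ⟨l, rfl⟩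
    simp only [hA, mul_sub]
    rw [Finset.sum_sub_distrib, ← Finset.sum_mul, hρ1, one_mul, sub_self])
  have hc : ∀ e, 0 < Real.exp (l e) := fun e => Real.exp_pos _
  refine ⟨fun e => Real.exp (l e), hc, ?_⟩
  funext e
  rw [relativeResistance, div_eq_iff (hG.kirchhoff_pos hc).ne']
  have hm : m (Pi.single e 1) = G.edgeMarginals ρ e := by
    simp [m, edgeMarginals, Finset.sum_filter]
  have hprod : ∀ T : G.SpanningTree,
      Real.exp (A l T) = (∏ t ∈ T.1, Real.exp (l t)) * Real.exp (-m l) := by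
    intro T
    rw [hA, sub_eq_add_neg, Real.exp_add, Real.exp_sum]
  have h := hl _ ⟨Pi.single e 1, rfl⟩
  simp only [hprod, ← mul_assoc] at h
  rw [← Finset.sum_mul] at h
  replace h := (mul_eq_zero.1 h).resolve_right (Real.exp_pos _).ne'
  simp only [hA, hm, sub_mul] at h
  rw [Finset.sum_sub_distrib, ← Finset.mul_sum, sub_eq_zero] at h
  rw [kirchhoff, ← h, Finset.sum_filter]
  refine Finset.sum_congr rfl fun T _ => ?_
  simp

/-! ### Uniqueness of weights up to rescaling in the blocks -/

theorem sum_mul_sum_eq_sum_mul_edgeMarginals [Fintype G.edgeSet] (μ : G.SpanningTree → ℝ)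
    (l : G.edgeSet → ℝ) :
    ∑ T : G.SpanningTree, μ T * ∑ t ∈ T.1, l t = ∑ e, l e * G.edgeMarginals μ e := by
  classical
  simp only [edgeMarginals, Finset.sum_filter, Finset.mul_sum]
  rw [Finset.sum_comm]
  refine Finset.sum_congr rfl fun T _ => ?_
  simp [mul_comm]

/-- Two log-linear distributions with the same marginals agree: their log-densities are sums over
the edges, so the symmetrized relative entropy only depends on the marginals. -/
theorem Connected.weightedTreeDistribution_eq_of_relativeResistance_eq (hG : G.Connected)
    {c c' : G.edgeSet → ℝ} (hc : ∀ e, 0 < c e) (hc' : ∀ e, 0 < c' e)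
    (h : G.relativeResistance c = G.relativeResistance c') :
    G.weightedTreeDistribution c = G.weightedTreeDistribution c' := by
  have := Fintype.ofFinite G.edgeSet
  have hlog : ∀ {c : G.edgeSet → ℝ}, (∀ e, 0 < c e) → ∀ T : G.SpanningTree,
      Real.log (G.weightedTreeDistribution c T) =
        ∑ t ∈ T.1, Real.log (c t) - Real.log (G.kirchhoff c) := by
    intro c hc T
    rw [weightedTreeDistribution, Real.log_div (Finset.prod_pos fun e _ => hc e).ne'
      (hG.kirchhoff_pos hc).ne', Real.log_prod fun e _ => (hc e).ne']
  have hp := hG.weightedTreeDistribution_mem_positiveDistributions hc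
  have hq := hG.weightedTreeDistribution_mem_positiveDistributions hc'
  rw [relativeResistance_eq_edgeMarginals, relativeResistance_eq_edgeMarginals] at h
  refine eq_of_sum_sub_mul_log_sub_eq_zero hp.2 hq.2 ?_
  have hlin := sum_mul_sum_eq_sum_mul_edgeMarginals (G.weightedTreeDistribution c)
    fun e => Real.log (c e) - Real.log (c' e)
  rw [h, ← sum_mul_sum_eq_sum_mul_edgeMarginals] at hlin
  have hconst : ∑ T, (G.weightedTreeDistribution c T - G.weightedTreeDistribution c' T) *
      (Real.log (G.kirchhoff c') - Real.log (G.kirchhoff c)) = 0 := by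
    rw [← Finset.sum_mul, Finset.sum_sub_distrib, hp.1.2, hq.1.2, sub_self, zero_mul]
  rw [← sub_eq_zero, ← Finset.sum_sub_distrib] at hlin
  refine Eq.trans ?_ ((congrArg₂ (· + ·) hlin hconst).trans (add_zero 0))
  rw [← Finset.sum_add_distrib]
  refine Finset.sum_congr rfl fun T _ => ?_
  rw [hlog hc, hlog hc', Finset.sum_sub_distrib]
  ring

theorem Connected.relativeResistance_eq_iff_prod_div_eq (hG : G.Connected)
    {c c' : G.edgeSet → ℝ} (hc : ∀ e, 0 < c e) (hc' : ∀ e, 0 < c' e) :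
    G.relativeResistance c' = G.relativeResistance c ↔
      ∀ T T' : Finset G.edgeSet, G.IsSpanningTree T → G.IsSpanningTree T' →
        ∏ t ∈ T, c' t / c t = ∏ t ∈ T', c' t / c t := by
  have hpos : ∀ {c : G.edgeSet → ℝ}, (∀ e, 0 < c e) → ∀ T : Finset G.edgeSet, 0 < ∏ t ∈ T, c t :=
    fun hc T => Finset.prod_pos fun e _ => hc e
  have hZ := hG.kirchhoff_pos hc
  have hZ' := hG.kirchhoff_pos hc'
  constructor
  · intro h
    have hw := hG.weightedTreeDistribution_eq_of_relativeResistance_eq hc' hc h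
    have key : ∀ T, G.IsSpanningTree T →
        ∏ t ∈ T, c' t / c t = G.kirchhoff c' / G.kirchhoff c := by
      intro T hT
      have := congrFun hw ⟨T, hT⟩
      simp only [weightedTreeDistribution] at this
      rw [Finset.prod_div_distrib]
      rw [div_eq_div_iff hZ'.ne' hZ.ne'] at this
      rw [div_eq_div_iff (hpos hc T).ne' hZ.ne', this, mul_comm]
    intro T T' hT hT'
    rw [key T hT, key T' hT']
  · intro h
    obtain ⟨T₀⟩ := hG.nonempty_spanningTree
    set κ : ℝ := ∏ t ∈ T₀.1, c' t / c t with hκ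
    have hκ0 : 0 < κ := hpos (fun e => div_pos (hc' e) (hc e)) _
    have hprod : ∀ T : G.SpanningTree, ∏ t ∈ T.1, c' t = κ * ∏ t ∈ T.1, c t := by
      intro T
      rw [hκ, h T₀.1 T.1 T₀.2 T.2, Finset.prod_div_distrib, div_mul_cancel₀ _ (hpos hc _).ne']
    have hk : G.kirchhoff c' = κ * G.kirchhoff c := by
      simp only [kirchhoff, hprod, Finset.mul_sum]
    rw [relativeResistance_eq_edgeMarginals, relativeResistance_eq_edgeMarginals]
    congr 1
    funext T
    simp only [weightedTreeDistribution]
    rw [hprod, hk, mul_div_mul_left _ _ hκ0.ne']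

theorem Connected.relativeResistance_eq_iff_eqUpToRescaling (hG : G.Connected)
    {c c' : G.edgeSet → ℝ} (hc : ∀ e, 0 < c e) (hc' : ∀ e, 0 < c' e) :
    G.relativeResistance c' = G.relativeResistance c ↔ G.EqUpToRescaling c c' := by
  rw [hG.relativeResistance_eq_iff_prod_div_eq hc hc']
  constructor
  · intro h U hU
    by_cases hne : ∃ e : G.edgeSet, ∀ v ∈ (e : Sym2 V), v ∈ U
    · obtain ⟨e₀, he₀⟩ := hne
      refine ⟨c' e₀ / c e₀, div_pos (hc' _) (hc _), fun e he => ?_⟩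
      rw [← div_eq_iff (hc e).ne']
      exact hG.eq_of_isBiconnectedComponent (d := fun e => c' e / c e)
        (fun e => (div_pos (hc' e) (hc e)).ne') h hU e e₀ he he₀
    · exact ⟨1, one_pos, fun e he => absurd ⟨e, he⟩ hne⟩
  · intro h T T' hT hT'
    refine hG.prod_spanningTree_eq (d := fun e => c' e / c e) (fun U hU e f he hf => ?_) hT hT'
    obtain ⟨a, -, ha⟩ := h U hU
    rw [div_eq_div_iff (hc e).ne' (hc f).ne', ha e he, ha f hf]
    ring

end SimpleGraph

theorem mainTheorem5 {V : Type*} [Finite V] (G : SimpleGraph V) (hG : G.Connected) :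
    G.openSpanningTreePolytope = G.edgeMarginals '' G.nonSeparableDistributions ∧
    G.openSpanningTreePolytope = G.edgeMarginals '' G.positiveDistributions ∧
    G.openSpanningTreePolytope = G.edgeMarginals '' G.logLinearDistributions ∧
    G.openSpanningTreePolytope =
      G.relativeResistance '' {c : G.edgeSet → ℝ | ∀ e, 0 < c e} ∧
    ∀ r ∈ G.openSpanningTreePolytope,
      ∃ c : G.edgeSet → ℝ, (∀ e, 0 < c e) ∧ G.relativeResistance c = r ∧
        ∀ c' : G.edgeSet → ℝ, (∀ e, 0 < c' e) →
          (G.relativeResistance c' = r ↔ G.EqUpToRescaling c c') := by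
  have hpos := hG.openSpanningTreePolytope_eq_image_positiveDistributions
  have hres : G.openSpanningTreePolytope =
      G.relativeResistance '' {c : G.edgeSet → ℝ | ∀ e, 0 < c e} := by
    rw [hpos]
    apply Set.Subset.antisymm
    · rintro _ ⟨ρ, hρ, rfl⟩
      exact hG.exists_relativeResistance_eq hρ
    · rintro _ ⟨c, hc, rfl⟩
      exact ⟨_, hG.weightedTreeDistribution_mem_positiveDistributions hc,
        (SimpleGraph.relativeResistance_eq_edgeMarginals c).symm⟩
  refine ⟨hG.openSpanningTreePolytope_eq_image_nonSeparableDistributions, hpos, ?_, hres, ?_⟩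
  · rw [hres]
    apply Set.Subset.antisymm
    · rintro _ ⟨c, hc, rfl⟩
      exact ⟨_, ⟨c, hc, rfl⟩, (SimpleGraph.relativeResistance_eq_edgeMarginals c).symm⟩
    · rintro _ ⟨_, ⟨c, hc, rfl⟩, rfl⟩
      exact ⟨c, hc, SimpleGraph.relativeResistance_eq_edgeMarginals c⟩
  · intro r hr
    rw [hres] at hr
    obtain ⟨c, hc, rfl⟩ := hr
    exact ⟨c, hc, rfl, fun c' hc' => hG.relativeResistance_eq_iff_eqUpToRescaling hc hc'⟩
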